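/- A simple game is a pair $(N,\mathcal W)$ with $N=\{1,\dots,n\}$ and $\mathcal W$ a family of subsets of $N$ (the winning coalitions; all other subsets are losing) such that $N\in\mathcal W$, $\emptyset\notin\mathcal W$, and $S\in\mathcal W$, $S\subseteq T\subseteq N$ imply $T\in\mathcal W$. For $j\in\mathbb N$, a $j$-trade application is a tuple $(S_1,\dots,S_{2j})$ of coalitions, repetitions allowed, for which there is $I\subseteq\{1,\dots,2j\}$ with $|I|=j$ such that $S_i\in\mathcal W\iff i\in I$ for every $i$, and $|\{i\in I: p\in S_i\}|=|\{i\in\{1,\dots,2j\}\setminus I: p\in S_i\}|$ for every $p\in N$. The game is $j$-trade if it admits a $j$-trade application. Fix $j\in\mathbb N$. Let simple games be given by an explicit list of all their winning coalitions, in any order and possibly with repetitions, each coalition written as its characteristic vector of $n$ bits followed by an end marker. Then there are deterministic Turing machines (with several stacks) that run in time polynomial in the length of the input, the machine and the polynomial depending only on $j$, and that do the following on every such input $(N,\mathcal W)$: 1. the first machine decides whether the game is $j$-trade; 2. the second machine outputs a $j$-trade application of the game, as the list of its $2j$ characteristic vectors, if the game is $j$-trade, and reports failure otherwise. -/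

import Mathlib

namespace TradeGames

/-- A simple game with player set `N = Fin n`: a monotone family of winning coalitions that
contains `N` and does not contain the empty coalition. -/
structure SimpleGame (n : ℕ) where
  /-- the winning coalitions -/
  winning : Set (Finset (Fin n))
  univ_mem : Finset.univ ∈ winning
  empty_notMem : ∅ ∉ winning
  mono : ∀ S T : Finset (Fin n), S ∈ winning → S ⊆ T → T ∈ winning

/-- The `2j` coalitions `S` (repetitions allowed) form a `j`-trade application of `G`: for some
set `I` of `j` indices, the coalitions with index in `I` are winning, the others are losing, and
every player belongs to as many of the former as of the latter. -/
def SimpleGame.IsTradeApplication {n : ℕ} (G : SimpleGame n) (j : ℕ)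
    (S : Fin (2 * j) → Finset (Fin n)) : Prop :=
  ∃ I : Finset (Fin (2 * j)),
    I.card = j ∧
    (∀ i, S i ∈ G.winning ↔ i ∈ I) ∧
    ∀ p : Fin n, (I.filter fun i => p ∈ S i).card = (Iᶜ.filter fun i => p ∈ S i).card

/-- `G` is `j`-trade if it admits a `j`-trade application. -/
def SimpleGame.IsTrade {n : ℕ} (G : SimpleGame n) (j : ℕ) : Prop :=
  ∃ S : Fin (2 * j) → Finset (Fin n), G.IsTradeApplication j S

/-- A simple game presented by an explicit list of its winning coalitions, in any order. -/
structure ListedGame where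
  /-- the number of players -/
  n : ℕ
  /-- the game -/
  game : SimpleGame n
  /-- the list of the winning coalitions -/
  coalitions : List (Finset (Fin n))
  mem_coalitions : ∀ S, S ∈ coalitions ↔ S ∈ game.winning

/-- The characteristic vector of a coalition, a word of `n` bits. -/
def charVector {n : ℕ} (S : Finset (Fin n)) : List Bool :=
  List.ofFn fun p => decide (p ∈ S)

/-- A list of bit words as one string: the words are written one after the other, and each of
them is followed by the end marker `none`. -/
def encodeWords (ws : List (List Bool)) : List (Option Bool) :=
  ws.flatMap fun w => w.map some ++ [none]

/-- The input string of a listed game: the characteristic vectors of its winning coalitions. The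
number of players is the length of each of these vectors, and the list is never empty. -/
def encodeGame (G : ListedGame) : List (Option Bool) :=
  encodeWords (G.coalitions.map charVector)

/-- The output string of a search: the bit `0` for failure, and the bit `1` followed by the
string of the words found for success. -/
def encodeAnswer : Option (List (List Bool)) → List (Option Bool)
  | none => [some false]
  | some ws => some true :: encodeWords ws

theorem encodeWords_injective : Function.Injective encodeWords := by
  have key : ∀ (v w : List Bool) (r s : List (Option Bool)),
      v.map some ++ none :: r = w.map some ++ none :: s → v = w ∧ r = s := by
    intro v
    induction v with
    | nil => intro w r s h; cases w <;> simp_all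
    | cons a v ih =>
      intro w r s h
      cases w with
      | nil => simp at h
      | cons b w =>
        simp only [List.map_cons, List.cons_append, List.cons.injEq, Option.some.injEq] at h
        have := ih w r s h.2
        simp_all
  intro x
  induction x with
  | nil => intro y h; cases y <;> simp_all [encodeWords]
  | cons v x ih =>
    intro y h
    cases y with
    | nil => simp [encodeWords] at h
    | cons w y =>
      simp only [encodeWords, List.flatMap_cons, List.append_assoc, List.singleton_append] at h
      obtain ⟨h1, h2⟩ := key _ _ _ _ h
      rw [h1, ih h2]

theorem charVector_injective {n : ℕ} : Function.Injective (charVector (n := n)) := by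
  intro S T h
  ext p
  simpa using congrFun (List.ofFn_injective h) p

end TradeGames

namespace TradeGames

open Turing Turing.TM2 Turing.TM2.Stmt

/-! Only winning coalitions are listed, and there may be exponentially many losing ones, so the
losing half of a trade application cannot be enumerated directly. The remedy is to replace losing
coalitions by intersections of two winning ones.

A vetoer, that is, a player `p` with `N \ {p}` losing, lies in every winning coalition, hence by
balance in every losing coalition of a trade application. A losing coalition that contains all
vetoers extends to a maximal losing coalition `M`. At least two players `p ≠ q` are outside `M`, so
`M = (M ∪ {p}) ∩ (M ∪ {q})` with both sets winning (`SimpleGame.exists_subset_inter`). A trade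
application therefore gives `3j` winning coalitions as in `SimpleGame.IsDominatedTriple`.
Conversely, the intersections of such a triple can be thinned player by player until the counts
agree, and they stay losing by monotonicity (`SimpleGame.IsDominatedTriple.isTradeApplication`).

Thus it suffices to run through all `3j`-tuples of listed coalitions, of which there are
polynomially many for fixed `j`. An intersection is losing exactly when it differs from every listed
word. This test, the counting test and the thinning all work column by column with a finite memory,
so one generic machine performs the search. Its correctness and running time are
`TupleSearch.computableInPolyTime`; the tuples it finds are identified in
`mem_tuples_tradeSearch_iff`. -/

/-- The data of a brute-force search through all `N`-tuples of words of a list. The tuple is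
written as one word over the alphabet `C`, whose letters are the columns of the tuple. A
transducer with state space `τ` compares it with every word of the list and decides whether it is
kept; `R` rows, computed letter by letter, are the output for the first tuple kept. -/
structure TupleSearch where
  /-- length of the tuples -/
  N : ℕ
  /-- number of rows of the output -/
  R : ℕ
  /-- columns -/
  C : Type
  /-- output alphabet -/
  Ω : Type
  /-- states of the transducer -/
  τ : Type
  [fintypeC : Fintype C]
  [fintypeτ : Fintype τ]
  /-- the column of the empty tuple -/
  blank : C
  /-- `upd k c b` sets the entry `k` of the column `c` to `b` -/
  upd : ℕ → C → Bool → C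
  /-- initial state of the transducer -/
  init : τ
  /-- transition on a column of the tuple and a letter of the word compared with it -/
  next : τ → C → Bool → τ
  /-- transition at the end of a word -/
  wordEnd : τ → τ
  /-- is the tuple kept? -/
  keep : τ → Bool
  /-- the letters of the output rows -/
  row : ℕ → C → Ω
  /-- the output for failure -/
  fail : Ω
  /-- the first letter of the output for success -/
  succ : Ω
  /-- the end marker of the rows -/
  endMark : Ω

/-! ### The multi-stack machine of a tuple search -/

namespace TupleSearch

attribute [instance] TupleSearch.fintypeC TupleSearch.fintypeτ

/-- The stacks of the machine: the input and its popped part, the current list of tuples and the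
next one, the current tuple and its popped part, and the output. -/
inductive Stack
  | input | inputRev | list | acc | word | wordRev | output
  deriving DecidableEq

/-- The program labels of the machine. -/
inductive Label
  | copy | restore | refill | read | rewind | scan | restoreInput | flush
  | choose | readChosen | rows | row | unrow | clean
  deriving DecidableEq

instance : Fintype Stack where
  elems := {.input, .inputRev, .list, .acc, .word, .wordRev, .output}
  complete s := by cases s <;> simp

instance : Fintype Label where
  elems := {.copy, .restore, .refill, .read, .rewind, .scan, .restoreInput, .flush,
    .choose, .readChosen, .rows, .row, .unrow, .clean}
  complete l := by cases l <;> simp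

variable (P : TupleSearch)

/-- The stack alphabets of the machine. -/
abbrev Alphabet : Stack → Type
  | .input | .inputRev => Option Bool
  | .list | .acc => Option P.C
  | .word | .wordRev => P.C
  | .output => P.Ω

/-- The internal states of the machine: three registers for popped letters, the number of the
stage, the state of the transducer and the number of rows that are still to be written. -/
@[ext] structure Regs where
  /-- letter popped from the input -/
  x : Option (Option Bool)
  /-- letter popped from a list of tuples -/
  y : Option (Option P.C)
  /-- letter popped from a tuple -/
  z : Option P.C
  /-- stage -/
  k : Fin (P.N + 2)
  /-- transducer state -/
  t : P.τ
  /-- rows to be written -/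
  r : Fin (P.R + 1)

noncomputable instance : Fintype P.Regs :=
  Fintype.ofInjective
    (fun s : P.Regs => (s.x, s.y, s.z, s.k, s.t, s.r))
    (by
      intro s s' h
      simp only [Prod.mk.injEq] at h
      obtain ⟨h1, h2, h3, h4, h5, h6⟩ := h
      exact Regs.ext h1 h2 h3 h4 h5 h6)

/-- The initial internal state. -/
def start : P.Regs := ⟨none, none, none, 0, P.init, Fin.last _⟩

/-- Does the stage extend the tuples? -/
def Regs.emits {P : TupleSearch} (s : P.Regs) : Bool := decide (s.k.1 < P.N)

/-- Is the present tuple kept at the end of the stage? -/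
def Regs.keeps {P : TupleSearch} (s : P.Regs) : Bool := decide (s.k.1 = P.N) && P.keep s.t

/-- Clear the registers and jump. -/
def jump (l : Label) : Stmt P.Alphabet Label P.Regs :=
  load (fun s => { s with x := none, y := none, z := none }) (goto fun _ => l)

/-- Pop from one of the two input stacks. -/
def popX (i : Bool) (q : Stmt P.Alphabet Label P.Regs) : Stmt P.Alphabet Label P.Regs :=
  match i with
  | true => pop .input (fun s (a : Option (Option Bool)) => { s with x := a }) q
  | false => pop .inputRev (fun s (a : Option (Option Bool)) => { s with x := a }) q

/-- Pop from one of the two lists of tuples. -/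
def popY (i : Bool) (q : Stmt P.Alphabet Label P.Regs) : Stmt P.Alphabet Label P.Regs :=
  match i with
  | true => pop .list (fun s (a : Option (Option P.C)) => { s with y := a }) q
  | false => pop .acc (fun s (a : Option (Option P.C)) => { s with y := a }) q

/-- Pop from one of the two tuple stacks. -/
def popZ (i : Bool) (q : Stmt P.Alphabet Label P.Regs) : Stmt P.Alphabet Label P.Regs :=
  match i with
  | true => pop .word (fun s (a : Option P.C) => { s with z := a }) q
  | false => pop .wordRev (fun s (a : Option P.C) => { s with z := a }) q

/-- Push the column register. -/
def pushZ (i : Bool) (q : Stmt P.Alphabet Label P.Regs) : Stmt P.Alphabet Label P.Regs :=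
  match i with
  | true => push .word (fun s => (s.z.getD P.blank : P.C)) q
  | false => push .wordRev (fun s => (s.z.getD P.blank : P.C)) q

/-- The program of the machine. -/
def program : Label → Stmt P.Alphabet Label P.Regs
  | .copy =>
    P.popX true <| branch (fun s => s.x.isNone) (P.jump .restore) <|
    -- After the emptiness test the register holds a letter, so the outer default is never used.
    push .inputRev (fun s => (s.x.getD none : Option Bool)) <|
    -- Each input word contributes one blank tuple of the same length; the resulting multiplicities
    -- are harmless.
    push .acc (fun s => ((s.x.getD none).map fun _ => P.blank : Option P.C)) <|
    P.jump .copy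
  | .restore =>
    P.popX false <| branch (fun s => s.x.isNone) (P.jump .refill) <|
    push .input (fun s => (s.x.getD none : Option Bool)) <|
    P.jump .restore
  | .refill =>
    P.popY false <|
    branch (fun s => s.y.isNone)
      (branch (fun s => decide (s.k.1 = P.N + 1)) (P.jump .choose) (P.jump .read)) <|
    push .list (fun s => (s.y.getD none : Option P.C)) <|
    P.jump .refill
  | .read =>
    P.popY true <|
    branch (fun s => s.y.isNone)
      -- The cap only keeps the value in `Fin (P.N + 2)`: stages below `P.N` extend, stage `P.N`
      -- filters, and `P.N + 1` means that the list is final.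
      (load (fun s => { s with k := ⟨min (s.k.1 + 1) (P.N + 1), by omega⟩ }) <|
        P.jump .refill) <|
    branch (fun s => (s.y.getD none).isNone) (P.jump .rewind) <|
    push .wordRev (fun s => ((s.y.getD none).getD P.blank : P.C)) <|
    P.jump .read
  | .rewind =>
    P.popZ false <| branch (fun s => s.z.isNone) (P.jump .scan) <|
    P.pushZ true <| P.jump .rewind
  | .scan =>
    P.popX true <|
    branch (fun s => s.x.isNone) (P.jump .restoreInput) <|
    push .inputRev (fun s => (s.x.getD none : Option Bool)) <|
    branch (fun s => (s.x.getD none).isNone)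
      (load (fun s => { s with t := P.wordEnd s.t }) <|
        branch Regs.emits (push .acc (fun _ => (none : Option P.C)) <| P.jump .rewind)
          (P.jump .rewind)) <|
    -- The tuple is read in step with the input word and is kept on the other stack, from which
    -- `rewind` restores it for the next word. A missing column cannot occur when all words have the
    -- same length.
    P.popZ true <| P.pushZ false <|
    load (fun s =>
      { s with t := P.next s.t (s.z.getD P.blank) ((s.x.getD none).getD false) }) <|
    branch Regs.emits
      (push .acc (fun s =>
        (some (P.upd s.k (s.z.getD P.blank) ((s.x.getD none).getD false)) : Option P.C)) <|
        P.jump .scan)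
      (P.jump .scan)
  | .restoreInput =>
    P.popX false <| branch (fun s => s.x.isNone) (P.jump .flush) <|
    push .input (fun s => (s.x.getD none : Option Bool)) <|
    P.jump .restoreInput
  | .flush =>
    P.popZ true <|
    branch (fun s => s.z.isNone)
      (branch Regs.keeps
        (push .acc (fun _ => (none : Option P.C)) <| load (fun s => { s with t := P.init }) <|
          P.jump .read)
        (load (fun s => { s with t := P.init }) <| P.jump .read)) <|
    branch Regs.keeps (push .acc (fun s => (s.z : Option P.C)) <| P.jump .flush) <|
    P.jump .flush
  | .choose =>
    peek .list (fun s (a : Option (Option P.C)) => { s with y := a }) <|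
    branch (fun s => s.y.isNone)
      (push .output (fun _ => P.fail) <| P.jump .clean) <|
    P.jump .readChosen
  | .readChosen =>
    P.popY true <|
    branch (fun s => (s.y.getD none).isNone) (P.jump .rows) <|
    push .wordRev (fun s => ((s.y.getD none).getD P.blank : P.C)) <|
    P.jump .readChosen
  | .rows =>
    branch (fun s => decide (s.r.1 = 0)) (push .output (fun _ => P.succ) <| P.jump .clean) <|
    -- The output is a stack, so rows are produced from the last to the first, and each of them from
    -- its end marker backwards.
    load (fun s => { s with r := ⟨s.r.1 - 1, by omega⟩ }) <|
    push .output (fun _ => P.endMark) <| P.jump .row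
  | .row =>
    P.popZ false <| branch (fun s => s.z.isNone) (P.jump .unrow) <|
    P.pushZ true <|
    push .output (fun s => P.row s.r (s.z.getD P.blank)) <| P.jump .row
  | .unrow =>
    P.popZ true <| branch (fun s => s.z.isNone) (P.jump .rows) <|
    P.pushZ false <| P.jump .unrow
  | .clean =>
    P.popX true <| P.popY true <| P.popZ false <|
    branch (fun s => s.x.isNone && s.y.isNone && s.z.isNone)
      -- `haltList` demands the initial internal state and empty stacks other than the output.
      (load (fun _ => P.start) halt) <|
    P.jump .clean

/-- The machine of a tuple search. -/
noncomputable def machine : FinTM2 where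
  K := Stack
  k₀ := .input
  k₁ := .output
  Γ := P.Alphabet
  Λ := Label
  main := .copy
  σ := P.Regs
  initialState := P.start
  Γk₀Fin := inferInstanceAs (Fintype (Option Bool))
  m := P.program

/-! ### Configurations and timed runs -/

/-- The stacks with given contents. -/
def contents (V V' : List (Option Bool)) (A B : List (Option P.C)) (W W' : List P.C)
    (O : List P.Ω) : ∀ s, List (P.Alphabet s)
  | .input => V
  | .inputRev => V'
  | .list => A
  | .acc => B
  | .word => W
  | .wordRev => W'
  | .output => O

/-- The configuration with cleared registers and given stacks. -/
def cfg (l : Option Label) (k : Fin (P.N + 2)) (t : P.τ) (r : Fin (P.R + 1))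
    (V V' : List (Option Bool)) (A B : List (Option P.C)) (W W' : List P.C) (O : List P.Ω) :
    Cfg P.Alphabet Label P.Regs :=
  ⟨l, ⟨none, none, none, k, t, r⟩, P.contents V V' A B W W' O⟩

section updates
variable {P} (V V' : List (Option Bool)) (A B : List (Option P.C)) (W W' : List P.C)
  (O : List P.Ω)

theorem update_input (l : List (Option Bool)) :
    Function.update (P.contents V V' A B W W' O) .input l = P.contents l V' A B W W' O := by
  funext s; cases s <;> rfl

theorem update_inputRev (l : List (Option Bool)) :
    Function.update (P.contents V V' A B W W' O) .inputRev l = P.contents V l A B W W' O := by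
  funext s; cases s <;> rfl

theorem update_list (l : List (Option P.C)) :
    Function.update (P.contents V V' A B W W' O) .list l = P.contents V V' l B W W' O := by
  funext s; cases s <;> rfl

theorem update_acc (l : List (Option P.C)) :
    Function.update (P.contents V V' A B W W' O) .acc l = P.contents V V' A l W W' O := by
  funext s; cases s <;> rfl

theorem update_word (l : List P.C) :
    Function.update (P.contents V V' A B W W' O) .word l = P.contents V V' A B l W' O := by
  funext s; cases s <;> rfl

theorem update_wordRev (l : List P.C) :
    Function.update (P.contents V V' A B W W' O) .wordRev l = P.contents V V' A B W l O := by
  funext s; cases s <;> rfl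

theorem update_output (l : List P.Ω) :
    Function.update (P.contents V V' A B W W' O) .output l = P.contents V V' A B W W' l := by
  funext s; cases s <;> rfl

end updates

/-- The machine gets from `a` to `b` in at most `T` steps. -/
def ReachesIn (a b : Cfg P.Alphabet Label P.Regs) (T : ℕ) : Prop :=
  ∃ s ≤ T, (flip bind (step P.program))^[s] (some a) = some b

variable {P}

theorem ReachesIn.refl (a : Cfg P.Alphabet Label P.Regs) : P.ReachesIn a a 0 := ⟨0, le_rfl, rfl⟩

theorem ReachesIn.trans {a b c : Cfg P.Alphabet Label P.Regs} {S T : ℕ}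
    (h : P.ReachesIn a b S) (h' : P.ReachesIn b c T) : P.ReachesIn a c (S + T) := by
  obtain ⟨s, hs, h⟩ := h
  obtain ⟨t, ht, h'⟩ := h'
  refine ⟨t + s, by omega, ?_⟩
  rw [Function.iterate_add_apply, h, h']

theorem ReachesIn.mono {a b : Cfg P.Alphabet Label P.Regs} {S T : ℕ}
    (h : P.ReachesIn a b S) (hST : S ≤ T) : P.ReachesIn a b T := by
  obtain ⟨s, hs, h⟩ := h
  exact ⟨s, hs.trans hST, h⟩

theorem ReachesIn.head {a b c : Cfg P.Alphabet Label P.Regs} {T : ℕ}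
    (h : step P.program a = some b) (h' : P.ReachesIn b c T) : P.ReachesIn a c (T + 1) := by
  obtain ⟨t, ht, h'⟩ := h'
  refine ⟨t + 1, by omega, ?_⟩
  rw [Function.iterate_succ_apply]
  exact (congrArg _ h).trans h'

theorem ReachesIn.single {a b : Cfg P.Alphabet Label P.Regs}
    (h : step P.program a = some b) : P.ReachesIn a b 1 :=
  ReachesIn.head h (.refl b)

/-! ### Single steps of the program -/

section steps
variable (k : Fin (P.N + 2)) (t : P.τ) (r : Fin (P.R + 1)) (x : Option Bool)
  (y : Option P.C) (z : P.C)
  (V V' : List (Option Bool)) (A B : List (Option P.C)) (W W' : List P.C) (O : List P.Ω)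

theorem step_copy_nil :
    step P.program (P.cfg (some .copy) k t r [] V' A B W W' O) =
      some (P.cfg (some .restore) k t r [] V' A B W W' O) := by
  simp [cfg, program, popX, jump, contents, update_input]

theorem step_copy_cons :
    step P.program (P.cfg (some .copy) k t r (x :: V) V' A B W W' O) =
      some (P.cfg (some .copy) k t r V (x :: V') A (x.map (fun _ => P.blank) :: B) W W' O) := by
  simp [cfg, program, popX, jump, contents, update_input, update_inputRev, update_acc]

theorem step_restore_nil :
    step P.program (P.cfg (some .restore) k t r V [] A B W W' O) =
      some (P.cfg (some .refill) k t r V [] A B W W' O) := by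
  simp [cfg, program, popX, jump, contents, update_inputRev]

theorem step_restore_cons :
    step P.program (P.cfg (some .restore) k t r V (x :: V') A B W W' O) =
      some (P.cfg (some .restore) k t r (x :: V) V' A B W W' O) := by
  simp [cfg, program, popX, jump, contents, update_input, update_inputRev]

theorem step_refill_nil :
    step P.program (P.cfg (some .refill) k t r V V' A [] W W' O) =
      some (P.cfg (some (if k.1 = P.N + 1 then .choose else .read)) k t r V V' A [] W W' O) := by
  by_cases h : k.1 = P.N + 1 <;>
  simp [cfg, program, popY, jump, contents, h, update_acc]

theorem step_refill_cons :
    step P.program (P.cfg (some .refill) k t r V V' A (y :: B) W W' O) =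
      some (P.cfg (some .refill) k t r V V' (y :: A) B W W' O) := by
  simp [cfg, program, popY, jump, contents, update_list, update_acc]

theorem step_read_nil :
    step P.program (P.cfg (some .read) k t r V V' [] B W W' O) =
      some (P.cfg (some .refill) ⟨min (k.1 + 1) (P.N + 1), by omega⟩ t r V V' [] B W W' O) := by
  simp [cfg, program, popY, jump, contents, update_list]

theorem step_read_none :
    step P.program (P.cfg (some .read) k t r V V' (none :: A) B W W' O) =
      some (P.cfg (some .rewind) k t r V V' A B W W' O) := by
  simp [cfg, program, popY, jump, contents, update_list]

theorem step_read_some :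
    step P.program (P.cfg (some .read) k t r V V' (some z :: A) B W W' O) =
      some (P.cfg (some .read) k t r V V' A B W (z :: W') O) := by
  simp [cfg, program, popY, jump, contents, update_list, update_wordRev]

theorem step_rewind_nil :
    step P.program (P.cfg (some .rewind) k t r V V' A B W [] O) =
      some (P.cfg (some .scan) k t r V V' A B W [] O) := by
  simp [cfg, program, popZ, jump, contents, update_wordRev]

theorem step_rewind_cons :
    step P.program (P.cfg (some .rewind) k t r V V' A B W (z :: W') O) =
      some (P.cfg (some .rewind) k t r V V' A B (z :: W) W' O) := by
  simp [cfg, program, popZ, pushZ, jump, contents, update_word, update_wordRev]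

theorem step_scan_nil :
    step P.program (P.cfg (some .scan) k t r [] V' A B W W' O) =
      some (P.cfg (some .restoreInput) k t r [] V' A B W W' O) := by
  simp [cfg, program, popX, jump, contents, update_input]

theorem step_scan_none :
    step P.program (P.cfg (some .scan) k t r (none :: V) V' A B W W' O) =
      some (P.cfg (some .rewind) k (P.wordEnd t) r V (none :: V') A
        (if k.1 < P.N then none :: B else B) W W' O) := by
  by_cases h : k.1 < P.N <;>
  simp [cfg, program, popX, jump, contents, Regs.emits, h, update_input, update_inputRev,
    update_acc]

theorem step_scan_some (b : Bool) :
    step P.program (P.cfg (some .scan) k t r (some b :: V) V' A B (z :: W) W' O) =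
      some (P.cfg (some .scan) k (P.next t z b) r V (some b :: V') A
        (if k.1 < P.N then some (P.upd k z b) :: B else B) W (z :: W') O) := by
  by_cases h : k.1 < P.N <;>
  simp [cfg, program, popX, popZ, pushZ, jump, contents, Regs.emits, h, update_input,
    update_inputRev, update_acc, update_word, update_wordRev]

theorem step_restoreInput_nil :
    step P.program (P.cfg (some .restoreInput) k t r V [] A B W W' O) =
      some (P.cfg (some .flush) k t r V [] A B W W' O) := by
  simp [cfg, program, popX, jump, contents, update_inputRev]

theorem step_restoreInput_cons :
    step P.program (P.cfg (some .restoreInput) k t r V (x :: V') A B W W' O) =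
      some (P.cfg (some .restoreInput) k t r (x :: V) V' A B W W' O) := by
  simp [cfg, program, popX, jump, contents, update_input, update_inputRev]

theorem step_flush_nil :
    step P.program (P.cfg (some .flush) k t r V V' A B [] W' O) =
      some (P.cfg (some .read) k P.init r V V' A
        (if k.1 = P.N ∧ P.keep t then none :: B else B) [] W' O) := by
  by_cases h : k.1 = P.N <;> cases h' : P.keep t <;>
  simp [cfg, program, popZ, jump, contents, Regs.keeps, h, h', update_word, update_acc]

theorem step_flush_cons :
    step P.program (P.cfg (some .flush) k t r V V' A B (z :: W) W' O) =
      some (P.cfg (some .flush) k t r V V' A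
        (if k.1 = P.N ∧ P.keep t then some z :: B else B) W W' O) := by
  by_cases h : k.1 = P.N <;> cases h' : P.keep t <;>
  simp [cfg, program, popZ, jump, contents, Regs.keeps, h, h', update_word, update_acc]

theorem step_choose_nil :
    step P.program (P.cfg (some .choose) k t r V V' [] B W W' O) =
      some (P.cfg (some .clean) k t r V V' [] B W W' (P.fail :: O)) := by
  simp [cfg, program, jump, contents, update_output]

theorem step_choose_cons :
    step P.program (P.cfg (some .choose) k t r V V' (y :: A) B W W' O) =
      some (P.cfg (some .readChosen) k t r V V' (y :: A) B W W' O) := by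
  simp [cfg, program, jump, contents]

theorem step_readChosen_none :
    step P.program (P.cfg (some .readChosen) k t r V V' (none :: A) B W W' O) =
      some (P.cfg (some .rows) k t r V V' A B W W' O) := by
  simp [cfg, program, popY, jump, contents, update_list]

theorem step_readChosen_some :
    step P.program (P.cfg (some .readChosen) k t r V V' (some z :: A) B W W' O) =
      some (P.cfg (some .readChosen) k t r V V' A B W (z :: W') O) := by
  simp [cfg, program, popY, jump, contents, update_list, update_wordRev]

theorem step_rows_zero :
    step P.program (P.cfg (some .rows) k t 0 V V' A B W W' O) =
      some (P.cfg (some .clean) k t 0 V V' A B W W' (P.succ :: O)) := by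
  simp [cfg, program, jump, contents, update_output]

theorem step_rows_succ (i : ℕ) (hi : i + 1 < P.R + 1) :
    step P.program (P.cfg (some .rows) k t ⟨i + 1, hi⟩ V V' A B W W' O) =
      some (P.cfg (some .row) k t ⟨i, by omega⟩ V V' A B W W' (P.endMark :: O)) := by
  simp [cfg, program, jump, contents, update_output]

theorem step_row_nil :
    step P.program (P.cfg (some .row) k t r V V' A B W [] O) =
      some (P.cfg (some .unrow) k t r V V' A B W [] O) := by
  simp [cfg, program, popZ, jump, contents, update_wordRev]

theorem step_row_cons :
    step P.program (P.cfg (some .row) k t r V V' A B W (z :: W') O) =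
      some (P.cfg (some .row) k t r V V' A B (z :: W) W' (P.row r z :: O)) := by
  simp [cfg, program, popZ, pushZ, jump, contents, update_word, update_wordRev, update_output]

theorem step_unrow_nil :
    step P.program (P.cfg (some .unrow) k t r V V' A B [] W' O) =
      some (P.cfg (some .rows) k t r V V' A B [] W' O) := by
  simp [cfg, program, popZ, jump, contents, update_word]

theorem step_unrow_cons :
    step P.program (P.cfg (some .unrow) k t r V V' A B (z :: W) W' O) =
      some (P.cfg (some .unrow) k t r V V' A B W (z :: W') O) := by
  simp [cfg, program, popZ, pushZ, jump, contents, update_word, update_wordRev]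

theorem step_clean_nil :
    step P.program (P.cfg (some .clean) k t r [] V' [] B W [] O) =
      some (P.cfg none 0 P.init (Fin.last _) [] V' [] B W [] O) := by
  simp [cfg, program, popX, popY, popZ, contents, update_input, update_list, update_wordRev,
    start]

theorem step_clean (h : ¬ (V = [] ∧ A = [] ∧ W' = [])) :
    step P.program (P.cfg (some .clean) k t r V V' A B W W' O) =
      some (P.cfg (some .clean) k t r V.tail V' A.tail B W W'.tail O) := by
  cases V <;> cases A <;> cases W' <;>
  first
  | exact absurd ⟨rfl, rfl, rfl⟩ h
  | simp [cfg, program, popX, popY, popZ, jump, contents, update_input, update_list,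
      update_wordRev]

end steps

end TupleSearch

/-! ### Words with end markers -/

/-- A list of words over any alphabet as one string with end markers. -/
def markEnds {α : Type} (ws : List (List α)) : List (Option α) :=
  ws.flatMap fun w => w.map some ++ [none]

section markEnds
variable {α : Type}

@[simp] theorem markEnds_nil : markEnds ([] : List (List α)) = [] := rfl

@[simp] theorem markEnds_cons (w : List α) (ws : List (List α)) :
    markEnds (w :: ws) = w.map some ++ none :: markEnds ws := by
  simp [markEnds]

@[simp] theorem markEnds_append (us ws : List (List α)) :
    markEnds (us ++ ws) = markEnds us ++ markEnds ws := by
  simp [markEnds]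

theorem map_markEnds {β : Type} (f : α → β) (ws : List (List α)) :
    (markEnds ws).map (Option.map f) = markEnds (ws.map (List.map f)) := by
  induction ws with
  | nil => rfl
  | cons w ws ih => simp [ih, Function.comp_def]

theorem length_markEnds {n : ℕ} (ws : List (List α)) (h : ∀ w ∈ ws, w.length = n) :
    (markEnds ws).length = ws.length * (n + 1) := by
  induction ws with
  | nil => simp
  | cons w ws ih =>
    simp only [List.mem_cons, forall_eq_or_imp] at h
    simp [ih h.2, h.1]
    ring

end markEnds

namespace TupleSearch
variable {P : TupleSearch}

/-! ### What the search computes -/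

/-- The state of the transducer after a comparison of the tuple `a` with the word `v`. -/
def compareWord (P : TupleSearch) : P.τ → List P.C → List Bool → P.τ
  | t, z :: a, b :: v => P.compareWord (P.next t z b) a v
  | t, _, _ => P.wordEnd t

/-- The state of the transducer after a comparison of the tuple `a` with all words. -/
def compare (P : TupleSearch) (t : P.τ) (a : List P.C) (vs : List (List Bool)) : P.τ :=
  vs.foldl (fun t v => P.compareWord t a v) t

/-- The contribution of the tuple `a` to the next list of tuples. -/
def survivors (P : TupleSearch) (k : ℕ) (vs : List (List Bool)) (a : List P.C) :
    List (List P.C) :=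
  (if k < P.N then vs.map (List.zipWith (P.upd k) a) else []) ++
    if k = P.N ∧ P.keep (P.compare P.init a vs) then [a] else []

/-- The list of tuples before stage `k`. -/
def tuples (P : TupleSearch) (vs : List (List Bool)) : ℕ → List (List P.C)
  | 0 => vs.map (List.map fun _ => P.blank)
  | k + 1 => (P.tuples vs k).flatMap (P.survivors k vs)

/-- The row `i` of a tuple, with its end marker. -/
def outputRow (P : TupleSearch) (a : List P.C) (i : ℕ) : List P.Ω := a.map (P.row i) ++ [P.endMark]

/-- The output of the search. -/
def answer (P : TupleSearch) (vs : List (List Bool)) : List P.Ω :=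
  match P.tuples vs (P.N + 1) with
  | [] => [P.fail]
  | a :: _ => P.succ :: (List.range P.R).flatMap (P.outputRow a)

/-! ### Correctness and cost of the loops -/

section loops
variable (k : Fin (P.N + 2)) (t : P.τ) (r : Fin (P.R + 1))

theorem reaches_copy (V V' : List (Option Bool)) (A B : List (Option P.C)) (W W' : List P.C)
    (O : List P.Ω) :
    P.ReachesIn (P.cfg (some .copy) k t r V V' A B W W' O)
      (P.cfg (some .restore) k t r [] (V.reverse ++ V') A
        ((V.map (Option.map fun _ => P.blank)).reverse ++ B) W W' O) (V.length + 1) := by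
  induction V generalizing V' B with
  | nil => exact .single (step_copy_nil ..)
  | cons x V ih => exact .head (step_copy_cons ..) (by simpa using ih (x :: V') _)

theorem reaches_restore (V V' : List (Option Bool)) (A B : List (Option P.C)) (W W' : List P.C)
    (O : List P.Ω) :
    P.ReachesIn (P.cfg (some .restore) k t r V V' A B W W' O)
      (P.cfg (some .refill) k t r (V'.reverse ++ V) [] A B W W' O) (V'.length + 1) := by
  induction V' generalizing V with
  | nil => exact .single (step_restore_nil ..)
  | cons x V' ih => exact .head (step_restore_cons ..) (by simpa using ih (x :: V))

theorem reaches_refill (V V' : List (Option Bool)) (A B : List (Option P.C)) (W W' : List P.C)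
    (O : List P.Ω) :
    P.ReachesIn (P.cfg (some .refill) k t r V V' A B W W' O)
      (P.cfg (some (if k.1 = P.N + 1 then .choose else .read)) k t r V V' (B.reverse ++ A) [] W W'
        O) (B.length + 1) := by
  induction B generalizing A with
  | nil => exact .single (step_refill_nil ..)
  | cons y B ih => exact .head (step_refill_cons ..) (by simpa using ih (y :: A))

theorem reaches_read (a : List P.C) (V V' : List (Option Bool)) (A B : List (Option P.C))
    (W W' : List P.C) (O : List P.Ω) :
    P.ReachesIn (P.cfg (some .read) k t r V V' (a.map some ++ none :: A) B W W' O)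
      (P.cfg (some .rewind) k t r V V' A B W (a.reverse ++ W') O) (a.length + 1) := by
  induction a generalizing W' with
  | nil => exact .single (step_read_none ..)
  | cons z a ih => exact .head (step_read_some ..) (by simpa using ih (z :: W'))

theorem reaches_rewind (V V' : List (Option Bool)) (A B : List (Option P.C))
    (W W' : List P.C) (O : List P.Ω) :
    P.ReachesIn (P.cfg (some .rewind) k t r V V' A B W W' O)
      (P.cfg (some .scan) k t r V V' A B (W'.reverse ++ W) [] O) (W'.length + 1) := by
  induction W' generalizing W with
  | nil => exact .single (step_rewind_nil ..)
  | cons z W' ih => exact .head (step_rewind_cons ..) (by simpa using ih (z :: W))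

theorem reaches_scan (v : List Bool) (a : List P.C) (hv : v.length = a.length)
    (V V' : List (Option Bool)) (A B : List (Option P.C)) (W' : List P.C) (O : List P.Ω) :
    P.ReachesIn (P.cfg (some .scan) k t r (v.map some ++ none :: V) V' A B a W' O)
      (P.cfg (some .rewind) k (P.compareWord t a v) r V
        (none :: ((v.map some).reverse ++ V')) A
        (if k.1 < P.N then none :: (((List.zipWith (P.upd k) a v).map some).reverse ++ B) else B)
        [] (a.reverse ++ W') O) (a.length + 1) := by
  induction a generalizing v t V' B W' with
  | nil =>
    obtain rfl : v = [] := by simpa using hv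
    exact .single (step_scan_none ..)
  | cons z a ih =>
    cases v with
    | nil => simp at hv
    | cons b v =>
      refine .head (step_scan_some ..) ?_
      have := ih (P.next t z b) v (by simpa using hv) (some b :: V')
        (if k.1 < P.N then some (P.upd k z b) :: B else B) (z :: W')
      by_cases h : k.1 < P.N <;> simpa [h, compareWord] using this

/-- Every word costs one rewind and one scan of the tuple, of `a.length + 1` steps each; a last
rewind and the step that notices the end of the input give the remaining terms. -/
theorem reaches_compare (vs : List (List Bool)) (a : List P.C)
    (hv : ∀ v ∈ vs, v.length = a.length)
    (V' : List (Option Bool)) (A B : List (Option P.C)) (O : List P.Ω) :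
    P.ReachesIn (P.cfg (some .rewind) k t r (markEnds vs) V' A B [] a.reverse O)
      (P.cfg (some .restoreInput) k (P.compare t a vs) r [] ((markEnds vs).reverse ++ V') A
        (if k.1 < P.N then (markEnds (vs.map (List.zipWith (P.upd k) a))).reverse ++ B else B)
        a [] O) ((2 * vs.length + 1) * (a.length + 1) + 1) := by
  induction vs generalizing t V' B with
  | nil =>
    have h := (reaches_rewind k t r [] V' A B [] a.reverse O).trans
      (.single (step_scan_nil ..))
    simpa [compare] using h
  | cons v vs ih =>
    simp only [List.mem_cons, forall_eq_or_imp] at hv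
    have h1 := reaches_rewind k t r (markEnds (v :: vs)) V' A B [] a.reverse O
    have h2 := reaches_scan k t r v a hv.1 (markEnds vs) V' A B [] O
    have h3 := ih (P.compareWord t a v) hv.2 (none :: ((v.map some).reverse ++ V'))
      (if k.1 < P.N then none :: (((List.zipWith (P.upd k) a v).map some).reverse ++ B) else B)
    simp only [List.reverse_reverse, List.append_nil, markEnds_cons] at h1 h2
    have h := ((h1.trans h2).trans h3).mono
      (T := (2 * (v :: vs).length + 1) * (a.length + 1) + 1) (by simp; linarith)
    by_cases hk : k.1 < P.N <;> simpa [hk, compare] using h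

theorem reaches_restoreInput (V V' : List (Option Bool)) (A B : List (Option P.C))
    (W W' : List P.C) (O : List P.Ω) :
    P.ReachesIn (P.cfg (some .restoreInput) k t r V V' A B W W' O)
      (P.cfg (some .flush) k t r (V'.reverse ++ V) [] A B W W' O) (V'.length + 1) := by
  induction V' generalizing V with
  | nil => exact .single (step_restoreInput_nil ..)
  | cons x V' ih => exact .head (step_restoreInput_cons ..) (by simpa using ih (x :: V))

theorem reaches_flush (V V' : List (Option Bool)) (A B : List (Option P.C))
    (a W' : List P.C) (O : List P.Ω) :
    P.ReachesIn (P.cfg (some .flush) k t r V V' A B a W' O)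
      (P.cfg (some .read) k P.init r V V' A
        (if k.1 = P.N ∧ P.keep t then none :: ((a.map some).reverse ++ B) else B) [] W' O)
      (a.length + 1) := by
  induction a generalizing B with
  | nil => exact .single (step_flush_nil ..)
  | cons z a ih =>
    refine .head (step_flush_cons ..) ?_
    have := ih (if k.1 = P.N ∧ P.keep t then some z :: B else B)
    by_cases h : k.1 = P.N ∧ P.keep t <;> simpa [h] using this

/-- One full pass over the input per tuple. The input and the working stacks are restored at the
end, so passes can be chained; the only trace is the tuple's contribution to the accumulator, in
reverse order. -/
theorem reaches_read_tuple {n : ℕ} (vs : List (List Bool)) (hv : ∀ v ∈ vs, v.length = n)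
    (a : List P.C) (ha : a.length = n) (A B : List (Option P.C)) (O : List P.Ω) :
    P.ReachesIn
      (P.cfg (some .read) k P.init r (markEnds vs) [] (a.map some ++ none :: A) B [] [] O)
      (P.cfg (some .read) k P.init r (markEnds vs) [] A
        ((markEnds (P.survivors k vs a)).reverse ++ B) [] [] O)
      (3 * (vs.length + 1) * (n + 1) + 2) := by
  subst ha
  have h1 := reaches_read k P.init r a (markEnds vs) [] A B [] [] O
  have h2 := reaches_compare k P.init r vs a hv [] A B O
  rw [← List.append_nil a.reverse] at h2
  have h3 := reaches_restoreInput k (P.compare P.init a vs) r [] ((markEnds vs).reverse ++ []) A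
    (if k.1 < P.N then (markEnds (vs.map (List.zipWith (P.upd k) a))).reverse ++ B else B) a [] O
  have h4 := reaches_flush k (P.compare P.init a vs) r (markEnds vs) [] A
    (if k.1 < P.N then (markEnds (vs.map (List.zipWith (P.upd k) a))).reverse ++ B else B) a [] O
  simp only [List.append_nil, List.reverse_reverse] at h1 h2 h3
  have h := (((h1.trans h2).trans h3).trans h4).mono
    (T := 3 * (vs.length + 1) * (a.length + 1) + 2)
    (by rw [List.length_reverse, length_markEnds vs hv]; linarith)
  by_cases hk : k.1 < P.N
  · simpa [survivors, hk, hk.ne] using h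
  · by_cases h' : k.1 = P.N ∧ P.keep (P.compare P.init a vs) <;>
      simpa [survivors, hk, h'] using h

theorem reaches_stage {n : ℕ} (vs : List (List Bool)) (hv : ∀ v ∈ vs, v.length = n)
    (as : List (List P.C)) (ha : ∀ a ∈ as, a.length = n) (B : List (Option P.C))
    (O : List P.Ω) :
    P.ReachesIn
      (P.cfg (some .read) k P.init r (markEnds vs) [] (markEnds as) B [] [] O)
      (P.cfg (some .refill) ⟨min (k.1 + 1) (P.N + 1), by omega⟩ P.init r (markEnds vs) [] []
        ((markEnds (as.flatMap (P.survivors k vs))).reverse ++ B) [] [] O)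
      (as.length * (3 * (vs.length + 1) * (n + 1) + 2) + 1) := by
  induction as generalizing B with
  | nil =>
    simpa using ReachesIn.single (step_read_nil k P.init r (markEnds vs) [] B [] [] O)
  | cons a as ih =>
    simp only [List.mem_cons, forall_eq_or_imp] at ha
    have h1 := reaches_read_tuple k r vs hv a ha.1 (markEnds as) B O
    have h := (h1.trans (ih ha.2 _)).mono
      (T := (a :: as).length * (3 * (vs.length + 1) * (n + 1) + 2) + 1) (by simp; linarith)
    simpa using h

theorem reaches_readChosen (a : List P.C) (V V' : List (Option Bool)) (A B : List (Option P.C))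
    (W W' : List P.C) (O : List P.Ω) :
    P.ReachesIn (P.cfg (some .readChosen) k t r V V' (a.map some ++ none :: A) B W W' O)
      (P.cfg (some .rows) k t r V V' A B W (a.reverse ++ W') O) (a.length + 1) := by
  induction a generalizing W' with
  | nil => exact .single (step_readChosen_none ..)
  | cons z a ih => exact .head (step_readChosen_some ..) (by simpa using ih (z :: W'))

theorem reaches_row (V V' : List (Option Bool)) (A B : List (Option P.C))
    (W W' : List P.C) (O : List P.Ω) :
    P.ReachesIn (P.cfg (some .row) k t r V V' A B W W' O)
      (P.cfg (some .unrow) k t r V V' A B (W'.reverse ++ W) []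
        ((W'.map (P.row r)).reverse ++ O)) (W'.length + 1) := by
  induction W' generalizing W O with
  | nil => exact .single (step_row_nil ..)
  | cons z W' ih => exact .head (step_row_cons ..) (by simpa using ih (z :: W) _)

theorem reaches_unrow (V V' : List (Option Bool)) (A B : List (Option P.C))
    (W W' : List P.C) (O : List P.Ω) :
    P.ReachesIn (P.cfg (some .unrow) k t r V V' A B W W' O)
      (P.cfg (some .rows) k t r V V' A B [] (W.reverse ++ W') O) (W.length + 1) := by
  induction W generalizing W' with
  | nil => exact .single (step_unrow_nil ..)
  | cons z W ih => exact .head (step_unrow_cons ..) (by simpa using ih (z :: W'))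

theorem reaches_rows (a : List P.C) (V V' : List (Option Bool)) (A B : List (Option P.C))
    (O : List P.Ω) (i : ℕ) (hi : i < P.R + 1) :
    P.ReachesIn (P.cfg (some .rows) k t ⟨i, hi⟩ V V' A B [] a.reverse O)
      (P.cfg (some .clean) k t 0 V V' A B [] a.reverse
        (P.succ :: ((List.range i).flatMap (P.outputRow a) ++ O))) (i * (2 * a.length + 3) + 1) := by
  induction i generalizing O with
  | zero => simpa using ReachesIn.single (step_rows_zero k t V V' A B [] a.reverse O)
  | succ i ih =>
    have h1 := reaches_row k t ⟨i, by omega⟩ V V' A B [] a.reverse (P.endMark :: O)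
    have h2 := reaches_unrow k t ⟨i, by omega⟩ V V' A B a []
      (a.map (P.row i) ++ P.endMark :: O)
    simp only [List.map_reverse, List.reverse_reverse, List.append_nil] at h1 h2
    have h := (ReachesIn.head (step_rows_succ k t V V' A B [] a.reverse O i hi)
      ((h1.trans h2).trans (ih (a.map (P.row i) ++ P.endMark :: O) (by omega)))).mono
      (T := (i + 1) * (2 * a.length + 3) + 1) (by simp; linarith)
    simpa [List.range_succ, outputRow] using h

/-- The three stacks are popped simultaneously, so a common bound on their heights bounds the time.
-/
theorem reaches_clean (T : ℕ) (V : List (Option Bool)) (A : List (Option P.C)) (W' : List P.C)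
    (O : List P.Ω) (hV : V.length ≤ T) (hA : A.length ≤ T) (hW : W'.length ≤ T) :
    P.ReachesIn (P.cfg (some .clean) k t r V [] A [] [] W' O)
      (P.cfg none 0 P.init (Fin.last _) [] [] [] [] [] [] O) (T + 1) := by
  induction T generalizing V A W' with
  | zero =>
    simp only [Nat.le_zero, List.length_eq_zero_iff] at hV hA hW
    subst hV hA hW
    exact .single (step_clean_nil ..)
  | succ T ih =>
    by_cases h : V = [] ∧ A = [] ∧ W' = []
    · obtain ⟨rfl, rfl, rfl⟩ := h
      exact (ReachesIn.single (step_clean_nil ..)).mono (by omega)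
    · exact .head (step_clean _ _ _ _ _ _ _ _ _ _ h)
        (ih _ _ _ (by simp; omega) (by simp; omega) (by simp; omega))

end loops

/-! ### Number of tuples and total running time -/

theorem length_of_mem_tuples {n : ℕ} {vs : List (List Bool)} (hv : ∀ v ∈ vs, v.length = n)
    (k : ℕ) : ∀ a ∈ P.tuples vs k, a.length = n := by
  induction k with
  | zero =>
    intro a ha
    obtain ⟨v, h, rfl⟩ := List.mem_map.1 ha
    simpa using hv v h
  | succ k ih =>
    intro a ha
    obtain ⟨b, hb, ha⟩ := List.mem_flatMap.1 ha
    have hb' := ih b hb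
    rw [survivors, List.mem_append] at ha
    rcases ha with ha | ha
    · split_ifs at ha
      · obtain ⟨v, h, rfl⟩ := List.mem_map.1 ha
        simp [hb', hv v h]
      · simp at ha
    · split_ifs at ha
      · rwa [List.mem_singleton.1 ha]
      · simp at ha

/-- At the filtering stage a tuple leaves at most itself, which is why the list of words must be
nonempty. -/
theorem length_survivors_le (k : ℕ) (vs : List (List Bool)) (hv : vs ≠ []) (a : List P.C) :
    (P.survivors k vs a).length ≤ vs.length := by
  have : 0 < vs.length := List.length_pos_iff.2 hv
  unfold survivors
  by_cases h : k < P.N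
  · simp [h, h.ne]
  · by_cases h' : k = P.N ∧ P.keep (P.compare P.init a vs) <;> simp [h, h']; omega

theorem length_tuples_le (vs : List (List Bool)) (hv : vs ≠ []) (k : ℕ) :
    (P.tuples vs k).length ≤ vs.length ^ (k + 1) := by
  induction k with
  | zero => simp [tuples]
  | succ k ih =>
    rw [tuples, List.length_flatMap]
    calc ((P.tuples vs k).map fun a => (P.survivors k vs a).length).sum
        ≤ ((P.tuples vs k).map fun _ => vs.length).sum :=
          List.sum_le_sum fun a _ => length_survivors_le k vs hv a
      _ = (P.tuples vs k).length * vs.length := by simp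
      _ ≤ vs.length ^ (k + 1) * vs.length := Nat.mul_le_mul_right _ ih
      _ = _ := (pow_succ ..).symm

/-- All stages are run one after the other. -/
theorem reaches_tuples {n : ℕ} (r : Fin (P.R + 1)) (vs : List (List Bool)) (hne : vs ≠ [])
    (hv : ∀ v ∈ vs, v.length = n) (k : ℕ) (hk : k < P.N + 2) :
    P.ReachesIn
      (P.cfg (some .read) 0 P.init r (markEnds vs) [] (markEnds (P.tuples vs 0)) [] [] [] [])
      (P.cfg (some (if k = P.N + 1 then .choose else .read)) ⟨k, hk⟩ P.init r (markEnds vs) []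
        (markEnds (P.tuples vs k)) [] [] [] [])
      (k * (11 * (markEnds vs).length ^ (P.N + 3))) := by
  induction k with
  | zero => simpa using ReachesIn.refl _
  | succ k ih =>
    have hk' : k ≠ P.N + 1 := by omega
    have h1 := ih (by omega)
    rw [if_neg hk'] at h1
    have h2 := reaches_stage ⟨k, by omega⟩ r vs hv (P.tuples vs k) (length_of_mem_tuples hv k) [] []
    have h3 := reaches_refill ⟨k + 1, hk⟩ P.init r (markEnds vs) []
      [] (markEnds (P.tuples vs (k + 1))).reverse [] [] []
    have hmin : min (k + 1) (P.N + 1) = k + 1 := by omega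
    simp only [List.append_nil, hmin] at h2 h3
    have h := (h1.trans h2).trans h3
    rw [List.reverse_reverse] at h
    refine h.mono ?_
    have hm : 0 < vs.length := List.length_pos_iff.2 hne
    rw [List.length_reverse, length_markEnds _ (length_of_mem_tuples hv (k + 1)),
      length_markEnds vs hv]
    set L := vs.length * (n + 1) with hL
    have hmL : vs.length ≤ L := Nat.le_mul_of_pos_right _ n.succ_pos
    have hnL : n + 1 ≤ L := Nat.le_mul_of_pos_left _ hm
    have hL1 : 0 < L := hm.trans_le hmL
    have e1 : (P.tuples vs k).length ≤ L ^ (P.N + 1) :=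
      (length_tuples_le vs hne k).trans
        ((Nat.pow_le_pow_left hmL _).trans (Nat.pow_le_pow_right hL1 (by omega)))
    have e2 : (P.tuples vs (k + 1)).length ≤ L ^ (P.N + 2) :=
      (length_tuples_le vs hne (k + 1)).trans
        ((Nat.pow_le_pow_left hmL _).trans (Nat.pow_le_pow_right hL1 (by omega)))
    have e3 : (P.tuples vs (k + 1)).length * (n + 1) ≤ L ^ (P.N + 3) :=
      (Nat.mul_le_mul e2 hnL).trans_eq (pow_succ ..).symm
    have e4 : 3 * (vs.length + 1) * (n + 1) + 2 ≤ 8 * L := by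
      have : 3 * (vs.length + 1) * (n + 1) = 3 * L + 3 * (n + 1) := by rw [hL]; ring
      omega
    have e5 : (P.tuples vs k).length * (3 * (vs.length + 1) * (n + 1) + 2) ≤
        8 * L ^ (P.N + 3) :=
      calc _ ≤ L ^ (P.N + 1) * (8 * L) := Nat.mul_le_mul e1 e4
        _ = 8 * L ^ (P.N + 2) := by ring
        _ ≤ 8 * L ^ (P.N + 3) :=
          Nat.mul_le_mul_left _ (Nat.pow_le_pow_right hL1 (by omega))
    -- The constant 11 is 8 for the passes over the tuples, 1 for moving the new list back, and 2
    -- for the two closing steps.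
    have e6 : 0 < L ^ (P.N + 3) := by positivity
    linarith

theorem reaches_answer {n : ℕ} (vs : List (List Bool)) (hne : vs ≠ [])
    (hv : ∀ v ∈ vs, v.length = n) :
    P.ReachesIn
      (P.cfg (some .copy) 0 P.init (Fin.last _) (markEnds vs) [] [] [] [] [] [])
      (P.cfg none 0 P.init (Fin.last _) [] [] [] [] [] [] (P.answer vs))
      ((11 * P.N + 3 * P.R + 30) * (markEnds vs).length ^ (P.N + 3)) := by
  have h1 := reaches_copy 0 P.init (Fin.last P.R) (markEnds vs) [] [] [] [] [] []
  have h2 := reaches_restore 0 P.init (Fin.last P.R) [] (markEnds vs).reverse []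
    (((markEnds vs).map (Option.map fun _ => P.blank)).reverse) [] [] []
  have h3 := reaches_refill 0 P.init (Fin.last P.R) (markEnds vs) [] []
    (((markEnds vs).map (Option.map fun _ => P.blank)).reverse) [] [] []
  have h4 := reaches_tuples (Fin.last P.R) vs hne hv (P.N + 1) (by omega)
  have h0 : ((0 : Fin (P.N + 2)) : ℕ) ≠ P.N + 1 := by simp
  simp only [List.append_nil, List.reverse_reverse, if_neg h0, if_true, List.length_reverse,
    List.length_map] at h1 h2 h3 h4
  rw [map_markEnds] at h1 h2 h3
  have h := ((h1.trans h2).trans h3).trans h4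
  have hm : 0 < vs.length := List.length_pos_iff.2 hne
  have hlen := length_tuples_le (P := P) vs hne (P.N + 1)
  have hlenA := length_markEnds _ (length_of_mem_tuples (P := P) hv (P.N + 1))
  have htu := length_of_mem_tuples (P := P) hv (P.N + 1)
  rw [length_markEnds vs hv] at h ⊢
  have hLV := length_markEnds vs hv
  set L := vs.length * (n + 1) with hL
  have hmL : vs.length ≤ L := Nat.le_mul_of_pos_right _ n.succ_pos
  have hnL : n + 1 ≤ L := Nat.le_mul_of_pos_left _ hm
  have hL1 : 0 < L := hm.trans_le hmL
  have hLX : L ≤ L ^ (P.N + 3) := Nat.le_self_pow (by omega) _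
  have eA : (markEnds (P.tuples vs (P.N + 1))).length ≤ L ^ (P.N + 3) := by
    rw [hlenA, pow_succ]
    exact Nat.mul_le_mul (hlen.trans (Nat.pow_le_pow_left hmL _)) hnL
  unfold answer
  rcases hT : P.tuples vs (P.N + 1) with _ | ⟨a, as⟩
  · rw [hT] at h
    have h5 := ReachesIn.head (step_choose_nil ⟨P.N + 1, by omega⟩ P.init (Fin.last P.R)
      (markEnds vs) [] [] [] [] [])
      (reaches_clean _ P.init (Fin.last P.R) L (markEnds vs) [] [] [P.fail]
        hLV.le (by simp) (by simp))
    exact (h.trans h5).mono (by nlinarith)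
  · rw [hT] at h eA htu
    have han : a.length = n := htu a (by simp)
    rw [markEnds_cons] at h eA
    -- The end marker makes the list stack nonempty even if the tuple itself is the empty word, so
    -- `choose` detects success correctly.
    obtain ⟨y, A, hA⟩ : ∃ y A, a.map some ++ none :: markEnds as = y :: A := by
      cases a <;> simp
    have h5 := step_choose_cons ⟨P.N + 1, by omega⟩ P.init (Fin.last P.R) y
      (markEnds vs) [] A [] [] [] []
    rw [← hA] at h5
    have h6 := reaches_readChosen ⟨P.N + 1, by omega⟩ P.init (Fin.last P.R) a
      (markEnds vs) [] (markEnds as) [] [] [] []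
    have h7 := reaches_rows ⟨P.N + 1, by omega⟩ P.init a
      (markEnds vs) [] (markEnds as) [] [] P.R (by omega)
    -- The unused tuples are still on the list stack, so cleaning is bounded by the size of the
    -- whole list rather than by the input length.
    have h8 := reaches_clean ⟨P.N + 1, by omega⟩ P.init 0 (L ^ (P.N + 3)) (markEnds vs)
      (markEnds as) a.reverse (P.succ :: (List.range P.R).flatMap (P.outputRow a))
      (hLV.le.trans hLX) (by simp at eA; omega) (by simp [han]; omega)
    simp only [List.append_nil] at h6 h7
    refine (h.trans (ReachesIn.head h5 ((h6.trans h7).trans h8))).mono ?_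
    rw [han]
    have e1 : P.R * (2 * n + 3) ≤ P.R * (3 * L ^ (P.N + 3)) :=
      Nat.mul_le_mul_left _ (by omega)
    linarith

/-- The search runs in polynomial time. -/
theorem computableInPolyTime (P : TupleSearch) {α β : Type} (ea : α → List (Option Bool))
    (eb : β → List P.Ω) (f : α → β) (words : α → List (List Bool)) (len : α → ℕ)
    (hwords : ∀ a, ea a = markEnds (words a)) (hne : ∀ a, words a ≠ [])
    (hlen : ∀ a, ∀ v ∈ words a, v.length = len a) (hf : ∀ a, eb (f a) = P.answer (words a)) :
    Nonempty (TM2ComputableInPolyTime ea eb f) := by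
  have hinit (V : List (Option Bool)) : initList P.machine V =
      P.cfg (some .copy) 0 P.init (Fin.last _) V [] [] [] [] [] [] := by
    refine congrArg (Cfg.mk _ _) ?_
    funext s
    cases s <;> rfl
  have hhalt (O : List P.Ω) : haltList P.machine O =
      P.cfg none 0 P.init (Fin.last _) [] [] [] [] [] [] O := by
    refine congrArg (Cfg.mk _ _) ?_
    funext s
    cases s <;> rfl
  have key (a : α) : ∃ s ≤ (11 * P.N + 3 * P.R + 30) * (ea a).length ^ (P.N + 3),
      (flip bind P.machine.step)^[s] (some (initList P.machine (ea a))) =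
      some (haltList P.machine (eb (f a))) := by
    have h := reaches_answer (P := P) (words a) (hne a) (hlen a)
    rw [← hinit, ← hhalt, ← hwords, ← hf] at h
    exact h
  choose s hs hs' using key
  exact ⟨{
    tm := P.machine
    inputAlphabet := Equiv.refl (Option Bool)
    outputAlphabet := Equiv.refl P.Ω
    time := Polynomial.C (11 * P.N + 3 * P.R + 30) * Polynomial.X ^ (P.N + 3)
    outputsFun := fun a =>
      ⟨⟨s a, (congrArg (fun l : List (Option Bool) =>
          (flip bind P.machine.step)^[s a] (some (initList P.machine l))) (List.map_id _)).trans
        ((hs' a).trans (congrArg (fun l : List P.Ω => some (haltList P.machine l))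
          (List.map_id _)).symm)⟩, by simpa using hs a⟩ }⟩

end TupleSearch

/-! ### Trades and triples of winning coalitions -/

/-- A losing coalition that contains all vetoers is contained in a losing intersection of two
winning coalitions. -/
theorem SimpleGame.exists_subset_inter {n : ℕ} (G : SimpleGame n) (L : Finset (Fin n))
    (hL : L ∉ G.winning) (hv : ∀ p, Finset.univ.erase p ∉ G.winning → p ∈ L) :
    ∃ A ∈ G.winning, ∃ B ∈ G.winning, A ∩ B ∉ G.winning ∧ L ⊆ A ∩ B := by
  -- Maximality makes every one-player extension of `M` winning.
  obtain ⟨M, hLM, hM⟩ := (Set.toFinite {M | M ∉ G.winning}).exists_le_maximal hL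
  have hins : ∀ p ∉ M, insert p M ∈ G.winning := by
    intro p hp
    by_contra h
    exact hp (hM.2 h (Finset.subset_insert p M) (Finset.mem_insert_self p M))
  obtain ⟨p, hp⟩ : ∃ p, p ∉ M := by
    by_contra! h
    exact hM.1 (Finset.eq_univ_of_forall h ▸ G.univ_mem)
  -- If `p` were the only player outside `M`, then `N \ {p}` would be losing, so `p` would be a
  -- vetoer and lie in `L ⊆ M`.
  obtain ⟨q, hqp, hq⟩ : ∃ q, q ≠ p ∧ q ∉ M := by
    by_contra! h
    refine hp (hLM (hv p fun hw => hM.1 (G.mono _ _ hw fun q hq => ?_)))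
    exact h q (Finset.ne_of_mem_erase hq)
  have hpq : insert p M ∩ insert q M = M := by
    ext x
    simp only [Finset.mem_inter, Finset.mem_insert]
    constructor
    · rintro ⟨rfl | h, rfl | h'⟩ <;> first | assumption | exact absurd rfl hqp
    · exact fun h => ⟨.inr h, .inr h⟩
  exact ⟨_, hins p hp, _, hins q hq, by rw [hpq]; exact hM.1, by rw [hpq]; exact hLM⟩

/-- The coalitions `f (0, i)` are winning, and so are `f (1, i)` and `f (2, i)`, whose
intersections are losing; no player is in more of the former than of the intersections. -/
def SimpleGame.IsDominatedTriple {n : ℕ} (G : SimpleGame n) (j : ℕ)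
    (f : Fin 3 × Fin j → Finset (Fin n)) : Prop :=
  (∀ t, f t ∈ G.winning) ∧ (∀ i, f (1, i) ∩ f (2, i) ∉ G.winning) ∧
    ∀ p, (Finset.univ.filter fun i => p ∈ f (0, i)).card ≤
      (Finset.univ.filter fun i => p ∈ f (1, i) ∩ f (2, i)).card

theorem card_filter_orderEmbOfFin {α : Type*} [LinearOrder α] (s : Finset α) {k : ℕ}
    (h : s.card = k) (p : α → Prop) [DecidablePred p] :
    (Finset.univ.filter fun i => p (s.orderEmbOfFin h i)).card = (s.filter p).card := by
  conv_rhs => rw [← Finset.map_orderEmbOfFin_univ s h, Finset.filter_map, Finset.card_map]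
  rfl

/-- Each losing coalition of the application is enlarged to a losing intersection of two winning
ones. Enlarging only raises the counts on the losing side, so balance weakens to an inequality. -/
theorem SimpleGame.IsTrade.exists_isDominatedTriple {n : ℕ} {G : SimpleGame n} {j : ℕ}
    (h : G.IsTrade j) : ∃ f, G.IsDominatedTriple j f := by
  obtain ⟨S, I, hI, hS, hp⟩ := h
  have hI' : Iᶜ.card = j := by
    rw [Finset.card_compl, Fintype.card_fin, hI]
    omega
  -- A vetoer is in all `j` winning coalitions, so balance puts it in all `j` losing ones.
  have hveto : ∀ p, Finset.univ.erase p ∉ G.winning → ∀ i ∈ Iᶜ, p ∈ S i := by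
    intro p hpv
    have h1 : I.filter (fun i => p ∈ S i) = I := by
      refine Finset.filter_true_of_mem fun i hi => ?_
      by_contra hpi
      refine hpv (G.mono _ _ ((hS i).2 hi) fun q hq => Finset.mem_erase.2 ⟨?_, Finset.mem_univ _⟩)
      rintro rfl
      exact hpi hq
    have h2 : Iᶜ.filter (fun i => p ∈ S i) = Iᶜ := by
      refine Finset.eq_of_subset_of_card_le (Finset.filter_subset _ _) ?_
      rw [← hp p, h1, hI, hI']
    intro i hi
    rw [← h2] at hi
    exact (Finset.mem_filter.1 hi).2
  have hmem (i : Fin j) : Iᶜ.orderEmbOfFin hI' i ∈ Iᶜ := Finset.orderEmbOfFin_mem _ _ _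
  have hinter (i : Fin j) := G.exists_subset_inter (S (Iᶜ.orderEmbOfFin hI' i))
    (fun h => Finset.mem_compl.1 (hmem i) ((hS _).1 h)) fun p hpv => hveto p hpv _ (hmem i)
  choose A hA B hB hAB hsub using hinter
  refine ⟨fun t => ![S (I.orderEmbOfFin hI t.2), A t.2, B t.2] t.1, ?_, hAB, ?_⟩
  · rintro ⟨t, i⟩
    fin_cases t
    · exact (hS _).2 (Finset.orderEmbOfFin_mem _ _ _)
    · exact hA i
    · exact hB i
  · intro p
    refine (card_filter_orderEmbOfFin I hI fun i => p ∈ S i).trans_le ?_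
    rw [hp p, ← card_filter_orderEmbOfFin Iᶜ hI' fun i => p ∈ S i]
    refine Finset.card_le_card fun i hi => ?_
    rw [Finset.mem_filter] at hi ⊢
    exact ⟨hi.1, hsub i hi.2⟩

/-! ### The columns of a triple -/

/-- The entry of the column `c` for the `i`-th intersection. -/
def meet {j : ℕ} (c : Fin 3 × Fin j → Bool) (i : Fin j) : Bool := c (1, i) && c (2, i)

/-- The indices `i` for which the entry `(0, i)` of the column is set. -/
def winners {j : ℕ} (c : Fin 3 × Fin j → Bool) : Finset (Fin j) :=
  Finset.univ.filter fun i => c (0, i) = true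

/-- The indices for which the entry of the intersection is set. -/
def meets {j : ℕ} (c : Fin 3 × Fin j → Bool) : Finset (Fin j) :=
  Finset.univ.filter fun i => meet c i = true

/-- As many of the indices in `meets c` as there are in `winners c`, if possible. -/
noncomputable def losers {j : ℕ} (c : Fin 3 × Fin j → Bool) : Finset (Fin j) :=
  if h : (winners c).card ≤ (meets c).card then (Finset.exists_subset_card_eq h).choose else ∅

theorem losers_subset {j : ℕ} (c : Fin 3 × Fin j → Bool) : losers c ⊆ meets c := by
  unfold losers
  split_ifs with h
  · exact (Finset.exists_subset_card_eq h).choose_spec.1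
  · simp

theorem card_losers {j : ℕ} (c : Fin 3 × Fin j → Bool)
    (h : (winners c).card ≤ (meets c).card) : (losers c).card = (winners c).card := by
  rw [losers, dif_pos h]
  exact (Finset.exists_subset_card_eq h).choose_spec.2

/-- The entry `r` of the column of a trade application. -/
noncomputable def tradeEntry {j : ℕ} (r : ℕ) (c : Fin 3 × Fin j → Bool) : Bool :=
  decide ((∃ i ∈ winners c, r = i) ∨ ∃ i ∈ losers c, r = j + i)

theorem tradeEntry_winner {j : ℕ} (i : Fin j) (c : Fin 3 × Fin j → Bool) :
    tradeEntry i c = true ↔ i ∈ winners c := by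
  simp only [tradeEntry, decide_eq_true_eq]
  constructor
  · rintro (⟨k, hk, h⟩ | ⟨k, hk, h⟩)
    · rwa [Fin.ext h]
    · omega
  · exact fun h => .inl ⟨i, h, rfl⟩

theorem tradeEntry_loser {j : ℕ} (i : Fin j) (c : Fin 3 × Fin j → Bool) :
    tradeEntry (j + i) c = true ↔ i ∈ losers c := by
  simp only [tradeEntry, decide_eq_true_eq]
  constructor
  · rintro (⟨k, hk, h⟩ | ⟨k, hk, h⟩)
    · omega
    · rwa [Fin.ext (Nat.add_left_cancel h)]
  · exact fun h => .inr ⟨i, h, rfl⟩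

/-- The column of the player `p`. -/
def column {n j : ℕ} (f : Fin 3 × Fin j → Finset (Fin n)) (p : Fin n) : Fin 3 × Fin j → Bool :=
  fun t => decide (p ∈ f t)

/-- For each player, surplus memberships in the intersections are deleted. The choice depends on the
column of that player alone, which lets the machine write the answer letter by letter. -/
theorem SimpleGame.IsDominatedTriple.isTradeApplication {n : ℕ} {G : SimpleGame n} {j : ℕ}
    {f : Fin 3 × Fin j → Finset (Fin n)} (h : G.IsDominatedTriple j f) :
    G.IsTradeApplication j
      fun r => Finset.univ.filter fun p => tradeEntry r (column f p) = true := by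
  obtain ⟨hw, hl, hc⟩ := h
  -- The first `j` rows are the winning coalitions, the last `j` the thinned intersections.
  let a : Fin j ↪ Fin (2 * j) := ⟨fun i => ⟨i, by omega⟩, fun i k h => by simpa [Fin.ext_iff] using h⟩
  let b : Fin j ↪ Fin (2 * j) :=
    ⟨fun i => ⟨j + i, by omega⟩, fun i k h => by simpa [Fin.ext_iff] using h⟩
  have ha (i : Fin j) : (a i : ℕ) = i := rfl
  have hb (i : Fin j) : (b i : ℕ) = j + i := rfl
  have hab : (Finset.univ.map a)ᶜ = Finset.univ.map b := by
    ext r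
    simp only [Finset.mem_compl, Finset.mem_map, Finset.mem_univ, true_and, not_exists]
    constructor
    · intro h
      have hr : ¬ r.1 < j := fun hr => h ⟨r, hr⟩ rfl
      exact ⟨⟨r.1 - j, by omega⟩, Fin.ext (by rw [hb]; simp; omega)⟩
    · rintro ⟨i, rfl⟩ k hk
      have := congrArg Fin.val hk
      rw [ha, hb] at this
      omega
  refine ⟨Finset.univ.map a, by simp, fun r => ?_, fun p => ?_⟩
  · constructor
    · intro hr
      by_contra hra
      rw [← Finset.mem_compl, hab, Finset.mem_map] at hra
      obtain ⟨i, -, rfl⟩ := hra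
      -- If a thinned row were winning, the losing intersection that contains it would be winning
      -- too.
      refine hl i (G.mono _ _ hr fun p hp => ?_)
      have := losers_subset _ ((tradeEntry_loser i _).1 (Finset.mem_filter.1 hp).2)
      simpa [meets, meet, column] using this
    · intro hr
      obtain ⟨i, -, rfl⟩ := Finset.mem_map.1 hr
      convert hw (0, i)
      ext p
      have := tradeEntry_winner i (column f p)
      simpa [winners, column, ha] using this
  · rw [hab, Finset.filter_map, Finset.filter_map, Finset.card_map, Finset.card_map]
    have h1 : Finset.univ.filter ((fun r : Fin (2 * j) => p ∈ Finset.univ.filter fun p =>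
        tradeEntry r (column f p) = true) ∘ a) = winners (column f p) := by
      ext i
      simpa [ha] using tradeEntry_winner i (column f p)
    have h2 : Finset.univ.filter ((fun r : Fin (2 * j) => p ∈ Finset.univ.filter fun p =>
        tradeEntry r (column f p) = true) ∘ b) = losers (column f p) := by
      ext i
      simpa [hb] using tradeEntry_loser i (column f p)
    have h3 := card_losers (column f p) (by simpa [winners, meets, meet, column] using hc p)
    exact (congrArg Finset.card h1).trans (h3.symm.trans (congrArg Finset.card h2).symm)

/-! ### The search for a trade application -/

/-- The search for a triple of winning coalitions that yields a `j`-trade application. The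
transducer remembers which of the intersections agree with the word read so far, and whether the
triple has been rejected. -/
noncomputable abbrev tradeSearch (j R : ℕ) (Ω : Type) (row : ℕ → (Fin 3 × Fin j → Bool) → Ω)
    (fail succ endMark : Ω) : TupleSearch where
  N := 3 * j
  R := R
  C := Fin 3 × Fin j → Bool
  Ω := Ω
  τ := (Fin j → Bool) × Bool
  blank := fun _ => false
  upd k c b := fun t => if (finProdFinEquiv t : ℕ) = k then b else c t
  init := (fun _ => true, false)
  next s c b := (fun i => s.1 i && (meet c i == b),
    s.2 || !decide ((winners c).card ≤ (meets c).card))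
  wordEnd s := (fun _ => true, s.2 || decide (∃ i, s.1 i = true))
  keep s := !s.2
  row := row
  fail := fail
  succ := succ
  endMark := endMark

section tradeSearch
variable {j R : ℕ} {Ω : Type} {row : ℕ → (Fin 3 × Fin j → Bool) → Ω} {fail succ endMark : Ω}

/-- A flag survives to the end of the word exactly if it was set and the rest of its intersection
agrees with `v`. Rejection is permanent, and the flags are reset for the next word. -/
theorem compareWord_tradeSearch (s : (Fin j → Bool) × Bool) (a : List (Fin 3 × Fin j → Bool))
    (v : List Bool) (hv : v.length = a.length) :
    ((tradeSearch j R Ω row fail succ endMark).compareWord s a v).1 = (fun _ => true) ∧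
    (((tradeSearch j R Ω row fail succ endMark).compareWord s a v).2 = false ↔
      s.2 = false ∧ (∀ c ∈ a, (winners c).card ≤ (meets c).card) ∧
        ∀ i, s.1 i = true → a.map (fun c => meet c i) ≠ v) := by
  induction a generalizing s v with
  | nil =>
    obtain rfl : v = [] := by simpa using hv
    simp [TupleSearch.compareWord]
  | cons c a ih =>
    cases v with
    | nil => simp at hv
    | cons b v =>
      rw [TupleSearch.compareWord]
      refine ⟨(ih _ v (by simpa using hv)).1, (ih _ v (by simpa using hv)).2.trans ?_⟩
      simp [and_assoc]

/-- The counting test is repeated during every comparison, hence its place under the quantifier over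
words; it would be vacuous for an empty list. -/
theorem compare_tradeSearch (vs : List (List Bool)) (a : List (Fin 3 × Fin j → Bool))
    (hv : ∀ v ∈ vs, v.length = a.length) (b : Bool) :
    ((tradeSearch j R Ω row fail succ endMark).compare (fun _ => true, b) a vs).2 = false ↔
      b = false ∧ ∀ v ∈ vs, (∀ c ∈ a, (winners c).card ≤ (meets c).card) ∧
        ∀ i, a.map (fun c => meet c i) ≠ v := by
  induction vs generalizing b with
  | nil => simp [TupleSearch.compare]
  | cons v vs ih =>
    simp only [List.mem_cons, forall_eq_or_imp] at hv
    obtain ⟨h1, h2⟩ := compareWord_tradeSearch (R := R) (row := row) (fail := fail)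
      (succ := succ) (endMark := endMark) (fun _ => true, b) a v hv.1
    have h3 : (tradeSearch j R Ω row fail succ endMark).compareWord (fun _ => true, b) a v =
      (fun _ => true, _) := Prod.ext h1 rfl
    have := ih hv.2 ((tradeSearch j R Ω row fail succ endMark).compareWord (fun _ => true, b) a v).2
    rw [← h3, h2] at this
    rw [TupleSearch.compare, List.foldl_cons]
    refine this.trans ?_
    simp [and_assoc]

/-- The word of the columns of the first `k` coalitions of a triple. -/
def partialColumns {n : ℕ} (k : ℕ) (f : Fin 3 × Fin j → Finset (Fin n)) :
    List (Fin 3 × Fin j → Bool) :=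
  List.ofFn fun p t => decide ((finProdFinEquiv t : ℕ) < k) && column f p t

/-- Stage `k` writes an arbitrary listed coalition into entry `k`. Entries from `k` on are still
blank, so `f` matters only on the first `k` indices and is otherwise free. -/
theorem mem_tuples_tradeSearch {n : ℕ} (cs : List (Finset (Fin n))) (hcs : cs ≠ []) (k : ℕ)
    (hk : k ≤ 3 * j) (a : List (Fin 3 × Fin j → Bool)) :
    a ∈ (tradeSearch j R Ω row fail succ endMark).tuples (cs.map charVector) k ↔
      ∃ f : Fin 3 × Fin j → Finset (Fin n), (∀ t, f t ∈ cs) ∧ a = partialColumns k f := by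
  induction k generalizing a with
  | zero =>
    obtain ⟨c, hc⟩ := List.exists_mem_of_ne_nil cs hcs
    have hblank (d : Finset (Fin n)) (f : Fin 3 × Fin j → Finset (Fin n)) :
        (charVector d).map (fun _ => (fun _ => false : Fin 3 × Fin j → Bool)) =
          partialColumns 0 f := by
      simp [charVector, partialColumns, List.map_ofFn, Function.comp_def]
    simp only [TupleSearch.tuples, List.map_map, List.mem_map]
    constructor
    · rintro ⟨d, -, rfl⟩
      exact ⟨fun _ => c, fun _ => hc, hblank _ _⟩
    · rintro ⟨f, -, rfl⟩
      exact ⟨c, hc, hblank _ _⟩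
  | succ k ih =>
    have hk' : k < 3 * j := hk
    have hsurv (b : List (Fin 3 × Fin j → Bool)) :
        (tradeSearch j R Ω row fail succ endMark).survivors k (cs.map charVector) b =
          cs.map fun c => List.zipWith
            (fun (c : Fin 3 × Fin j → Bool) b t => if (finProdFinEquiv t : ℕ) = k then b else c t)
            b (charVector c) := by
      have h : k < (tradeSearch j R Ω row fail succ endMark).N := hk'
      rw [TupleSearch.survivors, if_pos h, if_neg (fun h' => h.ne h'.1), List.append_nil,
        List.map_map]
      rfl
    have hzip (f : Fin 3 × Fin j → Finset (Fin n)) (c : Finset (Fin n)) :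
        List.zipWith
          (fun (c : Fin 3 × Fin j → Bool) b t => if (finProdFinEquiv t : ℕ) = k then b else c t)
          (partialColumns k f) (charVector c) =
        partialColumns (k + 1) (Function.update f (finProdFinEquiv.symm ⟨k, hk'⟩) c) := by
      refine List.ext_getElem (by simp [partialColumns, charVector]) fun i h1 h2 => ?_
      rw [List.getElem_zipWith]
      simp only [partialColumns, charVector, List.getElem_ofFn]
      funext t
      simp only [column, Function.update_apply, Equiv.eq_symm_apply, Fin.ext_iff]
      by_cases h : (finProdFinEquiv t : ℕ) = k
      · simp only [h, if_true, Nat.lt_succ_self, decide_true, Bool.true_and]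
      · simp only [h, if_false, Nat.lt_succ_iff_lt_or_eq, or_false]
        exact congrFun (List.getElem_ofFn _) t
    simp only [TupleSearch.tuples, List.mem_flatMap, hsurv, List.mem_map]
    constructor
    · rintro ⟨b, hb, c, hc, rfl⟩
      obtain ⟨f, hf, rfl⟩ := (ih hk'.le b).1 hb
      refine ⟨_, fun t => ?_, hzip f c⟩
      rw [Function.update_apply]
      split_ifs
      exacts [hc, hf t]
    -- The same `f` serves before the stage: overwriting its entry `k` by its own value changes
    -- nothing.
    · rintro ⟨f, hf, rfl⟩
      refine ⟨_, (ih hk'.le _).2 ⟨f, hf, rfl⟩, f (finProdFinEquiv.symm ⟨k, hk'⟩), hf _, ?_⟩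
      rw [hzip, Function.update_eq_self]

/-- The tuples found are the dominated triples of the game. -/
theorem mem_tuples_tradeSearch_iff (G : ListedGame) (a : List (Fin 3 × Fin j → Bool)) :
    a ∈ (tradeSearch j R Ω row fail succ endMark).tuples (G.coalitions.map charVector)
        (3 * j + 1) ↔
      ∃ f, G.game.IsDominatedTriple j f ∧ a = List.ofFn (column f) := by
  have hne : G.coalitions ≠ [] :=
    List.ne_nil_of_mem ((G.mem_coalitions _).2 G.game.univ_mem)
  have hsurv (b : List (Fin 3 × Fin j → Bool)) :
      a ∈ (tradeSearch j R Ω row fail succ endMark).survivors (3 * j)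
          (G.coalitions.map charVector) b ↔
        a = b ∧ ((tradeSearch j R Ω row fail succ endMark).compare (fun _ => true, false) b
          (G.coalitions.map charVector)).2 = false := by
    -- Stage `3 * j` no longer extends tuples, it only filters them.
    have h1 : ¬ 3 * j < (tradeSearch j R Ω row fail succ endMark).N := lt_irrefl _
    rw [TupleSearch.survivors, if_neg h1, List.nil_append]
    simp only [true_and]
    by_cases h : ((tradeSearch j R Ω row fail succ endMark).compare (fun _ => true, false) b
          (G.coalitions.map charVector)).2 = false
    · rw [if_pos (by simpa using h)]
      simp [h]
    · rw [if_neg (by simpa using h)]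
      simp [h]
  have hcol (f : Fin 3 × Fin j → Finset (Fin G.n)) :
      partialColumns (3 * j) f = List.ofFn (column f) := by
    refine congrArg List.ofFn (funext fun p => funext fun t => ?_)
    rw [decide_eq_true (finProdFinEquiv t).isLt, Bool.true_and]
  have hmeet (f : Fin 3 × Fin j → Finset (Fin G.n)) (i : Fin j) :
      (List.ofFn (column f)).map (fun c => meet c i) = charVector (f (1, i) ∩ f (2, i)) := by
    simp [charVector, List.map_ofFn, Function.comp_def, meet, column]
  have hkeep (f : Fin 3 × Fin j → Finset (Fin G.n)) :
      ((tradeSearch j R Ω row fail succ endMark).compare (fun _ => true, false)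
        (List.ofFn (column f)) (G.coalitions.map charVector)).2 = false ↔
      (∀ i, f (1, i) ∩ f (2, i) ∉ G.game.winning) ∧
        ∀ p, (Finset.univ.filter fun i => p ∈ f (0, i)).card ≤
          (Finset.univ.filter fun i => p ∈ f (1, i) ∩ f (2, i)).card := by
    rw [compare_tradeSearch _ _ (by simp [charVector])]
    -- One listed coalition is needed to extract the counting condition from under the quantifier
    -- over words.
    obtain ⟨c, hc⟩ := List.exists_mem_of_ne_nil _ hne
    simp only [List.mem_map, forall_exists_index, and_imp, forall_apply_eq_imp_iff₂, hmeet,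
      List.forall_mem_ofFn_iff, true_and, charVector_injective.ne_iff]
    have hw (p : Fin G.n) : winners (column f p) = Finset.univ.filter fun i => p ∈ f (0, i) := by
      simp [winners, column]
    have hm (p : Fin G.n) : meets (column f p) =
        Finset.univ.filter fun i => p ∈ f (1, i) ∩ f (2, i) := by
      simp [meets, meet, column]
    simp only [hw, hm]
    constructor
    · intro h
      exact ⟨fun i hi => (h _ ((G.mem_coalitions _).2 hi)).2 i rfl, (h c hc).1⟩
    · intro h d hd
      exact ⟨h.2, fun i hi => h.1 i ((G.mem_coalitions _).1 (hi ▸ hd))⟩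
  simp only [TupleSearch.tuples, List.mem_flatMap, hsurv,
    mem_tuples_tradeSearch G.coalitions hne (3 * j) le_rfl, hcol]
  constructor
  · rintro ⟨_, ⟨f, hf, rfl⟩, rfl, h⟩
    exact ⟨f, ⟨fun t => (G.mem_coalitions _).1 (hf t), (hkeep f).1 h⟩, rfl⟩
  · rintro ⟨f, ⟨hf, h⟩, rfl⟩
    exact ⟨_, ⟨f, fun t => (G.mem_coalitions _).2 (hf t), rfl⟩, rfl, (hkeep f).2 h⟩

/-- Here the two directions of the reduction meet: the search is exhaustive over dominated triples,
and these exist exactly for `j`-trade games. -/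
theorem tuples_tradeSearch_ne_nil_iff (G : ListedGame) :
    (tradeSearch j R Ω row fail succ endMark).tuples (G.coalitions.map charVector) (3 * j + 1) ≠ [] ↔
      G.game.IsTrade j := by
  constructor
  · intro h
    obtain ⟨a, ha⟩ := List.exists_mem_of_ne_nil _ h
    obtain ⟨f, hf, -⟩ := (mem_tuples_tradeSearch_iff G a).1 ha
    exact ⟨_, hf.isTradeApplication⟩
  · intro h
    obtain ⟨f, hf⟩ := h.exists_isDominatedTriple
    exact List.ne_nil_of_mem ((mem_tuples_tradeSearch_iff G _).2 ⟨f, hf, rfl⟩)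

theorem tradeSearch_computableInPolyTime {β : Type} (eb : β → List Ω) (f : ListedGame → β)
    (hf : ∀ G, eb (f G) =
      (tradeSearch j R Ω row fail succ endMark).answer (G.coalitions.map charVector)) :
    Nonempty (TM2ComputableInPolyTime encodeGame eb f) :=
  (tradeSearch j R Ω row fail succ endMark).computableInPolyTime encodeGame eb f
    (fun G => G.coalitions.map charVector) ListedGame.n (fun _ => rfl)
    (fun G => by
      simpa using List.ne_nil_of_mem ((G.mem_coalitions _).2 G.game.univ_mem))
    (fun G => by simp [charVector]) hf

end tradeSearch

end TradeGames

/-! ### The two machines -/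

theorem mainTheorem3 (j : ℕ) :
    (∃ d : TradeGames.ListedGame → Bool,
      Nonempty (Turing.TM2ComputableInPolyTime
        TradeGames.encodeGame Computability.encodeBool d) ∧
      ∀ G : TradeGames.ListedGame, d G = true ↔ G.game.IsTrade j) ∧
    (∃ f : TradeGames.ListedGame → Option (List (List Bool)),
      Nonempty (Turing.TM2ComputableInPolyTime
        TradeGames.encodeGame TradeGames.encodeAnswer f) ∧
      ∀ G : TradeGames.ListedGame,
        (G.game.IsTrade j →
          ∃ S : Fin (2 * j) → Finset (Fin G.n), G.game.IsTradeApplication j S ∧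
            f G = some (List.ofFn fun i => TradeGames.charVector (S i))) ∧
        (¬ G.game.IsTrade j → f G = none)) := by
  open TradeGames in
  constructor
  -- With no output rows, the answer is the single success bit, which is the encoding of a Boolean.
  · let P := tradeSearch j 0 Bool (fun _ _ => false) false true false
    refine ⟨fun G => !(P.tuples (G.coalitions.map charVector) (3 * j + 1)).isEmpty,
      tradeSearch_computableInPolyTime (j := j) (R := 0) (row := fun _ _ => false)
        (fail := false) (succ := true) (endMark := false) _ _ fun G => ?_, fun G => ?_⟩
    · change [!(P.tuples (G.coalitions.map charVector) (3 * j + 1)).isEmpty] =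
        match P.tuples (G.coalitions.map charVector) (3 * j + 1) with
        | [] => [false]
        | a :: _ => true :: (List.range 0).flatMap (P.outputRow a)
      cases P.tuples (G.coalitions.map charVector) (3 * j + 1) <;> simp
    · rw [← tuples_tradeSearch_ne_nil_iff G (R := 0) (row := fun _ _ => false)
        (fail := false) (succ := true) (endMark := false)]
      simp [P]
  -- The `2 * j` rows of the answer are the thinned coalitions, computed from the columns of the
  -- first triple found.
  · let P := tradeSearch j (2 * j) (Option Bool) (fun r c => some (tradeEntry r c))
      (some false) (some true) none
    refine ⟨fun G => (P.tuples (G.coalitions.map charVector) (3 * j + 1)).head?.map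
        fun a => (List.range (2 * j)).map fun r => a.map (tradeEntry r),
      tradeSearch_computableInPolyTime (j := j) (R := 2 * j)
        (row := fun r c => some (tradeEntry r c))
        (fail := some false) (succ := some true) (endMark := none) _ _ fun G => ?_, fun G => ⟨?_, ?_⟩⟩
    · change _ = match P.tuples (G.coalitions.map charVector) (3 * j + 1) with
        | [] => [some false]
        | a :: _ => some true :: (List.range (2 * j)).flatMap (P.outputRow a)
      cases P.tuples (G.coalitions.map charVector) (3 * j + 1) with
      | nil => rfl
      | cons a as =>
        simp only [List.head?_cons, Option.map_some, encodeAnswer, encodeWords, List.flatMap_map,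
          List.map_map]
        rfl
    · intro h
      rw [← tuples_tradeSearch_ne_nil_iff G (R := 2 * j)
        (row := fun r c => some (tradeEntry r c))
        (fail := some false) (succ := some true) (endMark := none)] at h
      obtain ⟨a, as, hT⟩ := List.exists_cons_of_ne_nil h
      obtain ⟨f, hf, ha⟩ := (mem_tuples_tradeSearch_iff G a).1 (hT ▸ List.mem_cons_self)
      refine ⟨_, hf.isTradeApplication, ?_⟩
      have hT' : P.tuples (G.coalitions.map charVector) (3 * j + 1) = a :: as := hT
      simp only [hT', List.head?_cons, Option.map_some, Option.some.injEq]
      refine List.ext_getElem (by simp) fun r h1 h2 => ?_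
      simp [ha, charVector, List.map_ofFn, Function.comp_def]
    · intro h
      rw [← tuples_tradeSearch_ne_nil_iff G (R := 2 * j)
        (row := fun r c => some (tradeEntry r c))
        (fail := some false) (succ := some true) (endMark := none), not_not] at h
      have hT' : P.tuples (G.coalitions.map charVector) (3 * j + 1) = [] := h
      simp only [hT']
      rfl
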